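/- All rings are commutative. Let $A \to B \xrightarrow{q} C$ be ring homomorphisms with $q$ surjective, and let $N$ be a $C$-module. Let $\mathrm{Exal}_A(B,C)$ be the set of equivalence classes of infinitesimal extensions $\xi = (0 \to C \xrightarrow{i} E \xrightarrow{p} B \to 0)$ of $B$ over $A$ by $C$: exact sequences in which $E$ is an $A$-algebra, $p$ is an $A$-algebra homomorphism, and $e \cdot i(c) = i(p(e)\cdot c)$ for all $e \in E$, $c \in C$; two are equivalent if there is an $A$-algebra homomorphism between the middle terms inducing the identity on $C$ and on $B$. Let $\mathrm{Ex}^2_B(N,N)$ $(\cong \mathrm{Ext}^2_B(N,N))$ be the set of classes of exact sequences of $B$-modules $0 \to N \to T_1 \to T_0 \to N \to 0$ for the equivalence relation generated by morphisms of exact sequences that are the identity on both ends. Both are $C$-modules: the sum is $[\xi]+[\xi'] = (+)_*\Delta^*[\xi\oplus\xi']$ (Baer sum; for algebra extensions, $\xi\oplus\xi'$ is $0 \to C\oplus C \to E\times E' \to B\times B \to 0$), and $c\in C$ acts by pushforward along multiplication by $c$ on $C$, respectively on the left-hand $N$. For an infinitesimal extension $\xi$ as above, regard $N$ as an $E$-module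 via $p$ and choose an exact sequence of $E$-modules $0 \to K \to F \to N \to 0$ with $F$ projective. It gives an exact sequence of $B$-modules $$\vartheta = \left(0 \to \mathrm{Tor}_1^E(B,N) \to B\otimes_E K \to B\otimes_E F \to B\otimes_E N = N \to 0\right).$$ Let $\partial \colon \mathrm{Tor}_1^E(B,N) \to C\otimes_E N \cong N$ be the connecting homomorphism associated with $\xi$ and $-\otimes_E N$, and put $$\psi([\xi]) = [\partial_*(\vartheta)] \in \mathrm{Ex}^2_B(N,N).$$ Then $\psi \colon \mathrm{Exal}_A(B,C) \to \mathrm{Ex}^2_B(N,N)$ is a well-defined homomorphism of $C$-modules; that is, there is a unique $C$-linear map $\psi$ satisfying $\psi([\xi]) = [\partial_*(\vartheta)]$ for every infinitesimal extension $\xi$ and every choice of $0 \to K \to F \to N \to 0$. -/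

import Mathlib

open TensorProduct

universe v u

/-! ## Yoneda `2`-extensions of modules -/

/-- A `2`-extension `0 → N → T₁ → T₀ → M → 0` of the `B`-module `M` by the `B`-module `N`. -/
structure TwoExt (B M N : Type u) [CommRing B] [AddCommGroup M] [Module B M]
    [AddCommGroup N] [Module B N] where
  T₁ : Type u
  T₀ : Type u
  [addCommGroup₁ : AddCommGroup T₁]
  [module₁ : Module B T₁]
  [addCommGroup₀ : AddCommGroup T₀]
  [module₀ : Module B T₀]
  i : N →ₗ[B] T₁
  d : T₁ →ₗ[B] T₀
  e : T₀ →ₗ[B] M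
  i_injective : Function.Injective i
  exact_i_d : Function.Exact i d
  exact_d_e : Function.Exact d e
  e_surjective : Function.Surjective e

namespace TwoExt

attribute [instance] addCommGroup₁ module₁ addCommGroup₀ module₀

variable {B M N N' N'' : Type u} [CommRing B] [AddCommGroup M] [Module B M]
  [AddCommGroup N] [Module B N] [AddCommGroup N'] [Module B N'] [AddCommGroup N''] [Module B N'']

/-- There is a morphism of exact sequences from `ξ` to `ξ'` which is `α` on the left-hand ends
and the identity of `M` on the right-hand ends. -/
def HasHom (α : N →ₗ[B] N') (ξ : TwoExt B M N) (ξ' : TwoExt B M N') : Prop :=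
  ∃ (f₁ : ξ.T₁ →ₗ[B] ξ'.T₁) (f₀ : ξ.T₀ →ₗ[B] ξ'.T₀),
    (∀ n, f₁ (ξ.i n) = ξ'.i (α n)) ∧ (∀ t, f₀ (ξ.d t) = ξ'.d (f₁ t)) ∧
      ∀ t, ξ'.e (f₀ t) = ξ.e t

/-- `ξ` and `ξ'` are directly related: there is a morphism of exact sequences from `ξ` to `ξ'`
which is the identity on `N` and on `M`. -/
def Related (ξ ξ' : TwoExt B M N) : Prop := HasHom LinearMap.id ξ ξ'

/-- The submodule `{(-α n, i n)}` of `N' ⊕ T₁`. -/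
def pushRel (α : N →ₗ[B] N') (ξ : TwoExt B M N) : Submodule B (N' × ξ.T₁) :=
  LinearMap.range (LinearMap.prod (-α) ξ.i)

lemma mem_pushRel {α : N →ₗ[B] N'} {ξ : TwoExt B M N} {x : N' × ξ.T₁} :
    x ∈ pushRel α ξ ↔ ∃ n, -α n = x.1 ∧ ξ.i n = x.2 := by
  simp [pushRel, Prod.ext_iff]

/-- The pushforward `α_*(ξ)`, that is `0 → N' → N' ⊕_N T₁ → T₀ → M → 0`. -/
def push (α : N →ₗ[B] N') (ξ : TwoExt B M N) : TwoExt B M N' where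
  T₁ := (N' × ξ.T₁) ⧸ pushRel α ξ
  T₀ := ξ.T₀
  i := (pushRel α ξ).mkQ ∘ₗ LinearMap.inl B N' ξ.T₁
  d := (pushRel α ξ).liftQ (ξ.d ∘ₗ LinearMap.snd B N' ξ.T₁) (by
    intro x hx
    obtain ⟨n, -, h⟩ := mem_pushRel.1 hx
    simp [← h, ξ.exact_i_d.apply_apply_eq_zero])
  e := ξ.e
  i_injective := by
    rw [injective_iff_map_eq_zero]
    intro n' h
    obtain ⟨n, h₁, h₂⟩ := mem_pushRel.1 ((Submodule.Quotient.mk_eq_zero _).1 h)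
    have : n = 0 := ξ.i_injective (by simpa using h₂)
    subst this
    simpa using h₁.symm
  exact_i_d := by
    intro x
    obtain ⟨⟨n', t⟩, rfl⟩ := Submodule.Quotient.mk_surjective _ x
    constructor
    · intro h
      obtain ⟨n, rfl⟩ := (ξ.exact_i_d t).1 h
      refine ⟨n' + α n, (Submodule.Quotient.eq _).2 (mem_pushRel.2 ⟨-n, ?_, ?_⟩)⟩ <;> simp
    · rintro ⟨m, h⟩
      rw [← h]
      simp
  exact_d_e := by
    intro t
    rw [ξ.exact_d_e t]
    constructor
    · rintro ⟨s, rfl⟩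
      exact ⟨Submodule.Quotient.mk (0, s), rfl⟩
    · rintro ⟨x, rfl⟩
      obtain ⟨⟨n', s⟩, rfl⟩ := Submodule.Quotient.mk_surjective _ x
      exact ⟨s, rfl⟩
  e_surjective := ξ.e_surjective

/-- The `2`-extension
`0 → N ⊕ N' → T₁ ⊕ T₁' → T₀ ×_M T₀' → M → 0`, i.e. the pullback of the direct sum `ξ ⊕ ξ'` along
the diagonal `M → M ⊕ M`. -/
def prod (ξ : TwoExt B M N) (ξ' : TwoExt B M N') : TwoExt B M (N × N') where
  T₁ := ξ.T₁ × ξ'.T₁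
  T₀ := LinearMap.eqLocus (ξ.e ∘ₗ LinearMap.fst B ξ.T₀ ξ'.T₀) (ξ'.e ∘ₗ LinearMap.snd B ξ.T₀ ξ'.T₀)
  i := LinearMap.prodMap ξ.i ξ'.i
  d := LinearMap.codRestrict _ (LinearMap.prodMap ξ.d ξ'.d) (by
    intro t
    simp [ξ.exact_d_e.apply_apply_eq_zero, ξ'.exact_d_e.apply_apply_eq_zero])
  e := ξ.e ∘ₗ LinearMap.fst B ξ.T₀ ξ'.T₀ ∘ₗ Submodule.subtype _
  i_injective := by
    rintro ⟨a, b⟩ ⟨a', b'⟩ h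
    simpa [Prod.ext_iff, ξ.i_injective.eq_iff, ξ'.i_injective.eq_iff] using h
  exact_i_d := by
    rintro ⟨a, b⟩
    constructor
    · intro h
      obtain ⟨x, rfl⟩ := (ξ.exact_i_d a).1 (congrArg (fun z => z.1.1) h)
      obtain ⟨y, rfl⟩ := (ξ'.exact_i_d b).1 (congrArg (fun z => z.1.2) h)
      exact ⟨(x, y), rfl⟩
    · rintro ⟨⟨x, y⟩, h⟩
      obtain ⟨rfl, rfl⟩ := Prod.ext_iff.1 h
      exact Subtype.ext (Prod.ext (ξ.exact_i_d.apply_apply_eq_zero x)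
        (ξ'.exact_i_d.apply_apply_eq_zero y))
  exact_d_e := by
    rintro ⟨⟨a, b⟩, hab⟩
    replace hab : ξ.e a = ξ'.e b := hab
    constructor
    · intro h
      replace h : ξ.e a = 0 := h
      obtain ⟨x, rfl⟩ := (ξ.exact_d_e a).1 h
      obtain ⟨y, rfl⟩ := (ξ'.exact_d_e b).1 (hab.symm.trans h)
      exact ⟨(x, y), rfl⟩
    · rintro ⟨⟨x, y⟩, h⟩
      have h' : ξ.d x = a := congrArg (fun z => z.1.1) h
      change ξ.e a = 0
      rw [← h', ξ.exact_d_e.apply_apply_eq_zero]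
  e_surjective := by
    intro m
    obtain ⟨a, ha⟩ := ξ.e_surjective m
    obtain ⟨b, hb⟩ := ξ'.e_surjective m
    exact ⟨⟨(a, b), ha.trans hb.symm⟩, ha⟩

variable (B M N) in
/-- The `2`-extension `0 → N → N → M → M → 0` with middle map `0`. -/
def trivial : TwoExt B M N where
  T₁ := N
  T₀ := M
  i := LinearMap.id
  d := 0
  e := LinearMap.id
  i_injective := Function.injective_id
  exact_i_d := by intro x; simp
  exact_d_e := by intro x; simp [eq_comm]
  e_surjective := Function.surjective_id

lemma HasHom.comp {α : N →ₗ[B] N'} {α' : N' →ₗ[B] N''} {ξ : TwoExt B M N} {ξ' : TwoExt B M N'}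
    {ξ'' : TwoExt B M N''} (h' : HasHom α' ξ' ξ'') (h : HasHom α ξ ξ') :
    HasHom (α' ∘ₗ α) ξ ξ'' := by
  obtain ⟨f₁, f₀, h₁, h₂, h₃⟩ := h
  obtain ⟨f₁', f₀', h₁', h₂', h₃'⟩ := h'
  exact ⟨f₁' ∘ₗ f₁, f₀' ∘ₗ f₀, by simp [h₁, h₁'], by simp [h₂, h₂'], by simp [h₃, h₃']⟩

lemma hasHom_push (α : N →ₗ[B] N') (ξ : TwoExt B M N) : HasHom α ξ (push α ξ) := by
  refine ⟨(pushRel α ξ).mkQ ∘ₗ LinearMap.inr B N' ξ.T₁, LinearMap.id, fun n => ?_,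
    fun t => rfl, fun t => rfl⟩
  exact (Submodule.Quotient.eq _).2 (mem_pushRel.2 ⟨n, by simp, by simp⟩)

/-- The universal property of the pushforward. -/
lemma HasHom.push_related {α : N →ₗ[B] N'} {ξ : TwoExt B M N} {ξ' : TwoExt B M N'}
    (h : HasHom α ξ ξ') : Related (push α ξ) ξ' := by
  obtain ⟨f₁, f₀, h₁, h₂, h₃⟩ := h
  refine ⟨(pushRel α ξ).liftQ (LinearMap.coprod ξ'.i f₁) ?_, f₀, fun n => ?_, fun t => ?_, h₃⟩
  · intro x hx
    obtain ⟨n, h, h'⟩ := mem_pushRel.1 hx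
    simp [← h, ← h', h₁]
  · change ξ'.i n + f₁ 0 = ξ'.i n
    simp
  · obtain ⟨⟨n', s⟩, rfl⟩ := Submodule.Quotient.mk_surjective _ t
    change f₀ (ξ.d s) = ξ'.d (ξ'.i n' + f₁ s)
    simp [h₂, ξ'.exact_i_d.apply_apply_eq_zero]

lemma HasHom.prod {N₁ N₂ : Type u} [AddCommGroup N₁] [Module B N₁] [AddCommGroup N₂] [Module B N₂]
    {α : N →ₗ[B] N₁} {β : N' →ₗ[B] N₂} {ξ : TwoExt B M N} {ξ' : TwoExt B M N'}
    {η : TwoExt B M N₁} {η' : TwoExt B M N₂} (h : HasHom α ξ η) (h' : HasHom β ξ' η') :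
    HasHom (LinearMap.prodMap α β) (ξ.prod ξ') (η.prod η') := by
  obtain ⟨f₁, f₀, h₁, h₂, h₃⟩ := h
  obtain ⟨g₁, g₀, k₁, k₂, k₃⟩ := h'
  refine ⟨LinearMap.prodMap f₁ g₁, LinearMap.restrict (LinearMap.prodMap f₀ g₀) ?_,
    fun n => ?_, fun t => ?_, fun t => h₃ _⟩
  · rintro ⟨a, b⟩ hab
    replace hab : ξ.e a = ξ'.e b := hab
    change η.e (f₀ a) = η'.e (g₀ b)
    rw [h₃, k₃, hab]
  · exact Prod.ext (h₁ _) (k₁ _)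
  · exact Subtype.ext (Prod.ext (h₂ _) (k₂ _))

lemma hasHom_id (ξ : TwoExt B M N) : HasHom LinearMap.id ξ ξ :=
  ⟨LinearMap.id, LinearMap.id, fun _ => rfl, fun _ => rfl, fun _ => rfl⟩

lemma hasHom_diag (ξ : TwoExt B M N) :
    HasHom (LinearMap.prod LinearMap.id LinearMap.id) ξ (ξ.prod ξ) :=
  ⟨LinearMap.prod LinearMap.id LinearMap.id,
    LinearMap.codRestrict _ (LinearMap.prod LinearMap.id LinearMap.id) (fun _ => rfl),
    fun _ => rfl, fun _ => rfl, fun _ => rfl⟩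

lemma hasHom_swap (ξ : TwoExt B M N) (ξ' : TwoExt B M N') :
    HasHom (LinearMap.prod (LinearMap.snd B N N') (LinearMap.fst B N N'))
      (ξ.prod ξ') (ξ'.prod ξ) :=
  ⟨LinearMap.prod (LinearMap.snd B _ _) (LinearMap.fst B _ _),
    LinearMap.restrict (LinearMap.prod (LinearMap.snd B _ _) (LinearMap.fst B _ _))
      (fun _ h => Eq.symm h),
    fun _ => rfl, fun _ => rfl, fun t => t.2.symm⟩

lemma hasHom_assoc (ξ : TwoExt B M N) (ξ' : TwoExt B M N') (ξ'' : TwoExt B M N'') :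
    HasHom (LinearEquiv.prodAssoc B N N' N'').toLinearMap
      ((ξ.prod ξ').prod ξ'') (ξ.prod (ξ'.prod ξ'')) := by
  refine ⟨(LinearEquiv.prodAssoc B _ _ _).toLinearMap,
    { toFun := fun t => ⟨(t.1.1.1.1, ⟨(t.1.1.1.2, t.1.2), ?_⟩), ?_⟩
      map_add' := fun _ _ => rfl
      map_smul' := fun _ _ => rfl }, fun _ => rfl, fun _ => rfl, fun _ => rfl⟩
  · exact Eq.trans (Eq.symm t.1.1.2) t.2
  · exact t.1.1.2

lemma hasHom_zero (ξ : TwoExt B M N) : HasHom (0 : N →ₗ[B] N') ξ (trivial B M N') :=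
  ⟨0, ξ.e, fun _ => by simp, fun t => ξ.exact_d_e.apply_apply_eq_zero t,
    fun _ => rfl⟩

end TwoExt

/-- `Ex_B²(M,N)`: the classes of `2`-extensions of `M` by `N` for the equivalence relation generated
by being directly related. -/
def Ex2 (B M N : Type u) [CommRing B] [AddCommGroup M] [Module B M]
    [AddCommGroup N] [Module B N] : Type (u + 1) :=
  Quot (TwoExt.Related (B := B) (M := M) (N := N))

namespace Ex2

variable {B M N N' N'' : Type u} [CommRing B] [AddCommGroup M] [Module B M]
  [AddCommGroup N] [Module B N] [AddCommGroup N'] [Module B N'] [AddCommGroup N''] [Module B N'']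

/-- The class `[ξ]` of a `2`-extension. -/
def mk (ξ : TwoExt B M N) : Ex2 B M N := Quot.mk _ ξ

/-- `α_* : Ex_B²(M,N) → Ex_B²(M,N')`. -/
def map (α : N →ₗ[B] N') : Ex2 B M N → Ex2 B M N' :=
  Quot.map (TwoExt.push α) fun _ ξ' h =>
    ((TwoExt.hasHom_push α ξ').comp h : TwoExt.HasHom (α ∘ₗ LinearMap.id) _ _).push_related

/-- The map `τ : Ex_B²(M,N) × Ex_B²(M,N') → Ex_B²(M,N ⊕ N')`. -/
def prod : Ex2 B M N → Ex2 B M N' → Ex2 B M (N × N') :=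
  Quot.map₂ TwoExt.prod (fun ξ _ _ h => (TwoExt.hasHom_id ξ).prod h)
    (fun _ _ ξ' h => TwoExt.HasHom.prod h (TwoExt.hasHom_id ξ'))

lemma map_mk {α : N →ₗ[B] N'} {ξ : TwoExt B M N} {ξ' : TwoExt B M N'}
    (h : TwoExt.HasHom α ξ ξ') : map α (mk ξ) = mk ξ' :=
  Quot.sound h.push_related

lemma map_map (α : N →ₗ[B] N') (α' : N' →ₗ[B] N'') (x : Ex2 B M N) :
    map α' (map α x) = map (α' ∘ₗ α) x := by
  induction x using Quot.ind with | mk ξ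
  exact (map_mk ((TwoExt.hasHom_push α' _).comp (TwoExt.hasHom_push α ξ))).symm

lemma map_id (x : Ex2 B M N) : map LinearMap.id x = x := by
  induction x using Quot.ind with | mk ξ
  exact map_mk (TwoExt.hasHom_id ξ)

lemma map_prod {N₁ N₂ : Type u} [AddCommGroup N₁] [Module B N₁] [AddCommGroup N₂] [Module B N₂]
    (α : N →ₗ[B] N₁) (β : N' →ₗ[B] N₂) (x : Ex2 B M N) (y : Ex2 B M N') :
    map (LinearMap.prodMap α β) (prod x y) = prod (map α x) (map β y) := by
  induction x using Quot.ind with | mk ξ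
  induction y using Quot.ind with | mk ξ'
  exact map_mk ((TwoExt.hasHom_push α ξ).prod (TwoExt.hasHom_push β ξ'))

lemma map_diag (x : Ex2 B M N) :
    map (LinearMap.prod LinearMap.id LinearMap.id) x = prod x x := by
  induction x using Quot.ind with | mk ξ
  exact map_mk (TwoExt.hasHom_diag ξ)

lemma map_swap (x : Ex2 B M N) (y : Ex2 B M N') :
    map (LinearMap.prod (LinearMap.snd B N N') (LinearMap.fst B N N')) (prod x y) = prod y x := by
  induction x using Quot.ind with | mk ξ
  induction y using Quot.ind with | mk ξ'
  exact map_mk (TwoExt.hasHom_swap ξ ξ')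

lemma map_assoc (x : Ex2 B M N) (y : Ex2 B M N') (z : Ex2 B M N'') :
    map (LinearEquiv.prodAssoc B N N' N'').toLinearMap (prod (prod x y) z) =
      prod x (prod y z) := by
  induction x using Quot.ind with | mk ξ
  induction y using Quot.ind with | mk ξ'
  induction z using Quot.ind with | mk ξ''
  exact map_mk (TwoExt.hasHom_assoc ξ ξ' ξ'')

/-- The Baer sum. -/
instance : Add (Ex2 B M N) :=
  ⟨fun x y => map (LinearMap.coprod LinearMap.id LinearMap.id) (prod x y)⟩

instance : Zero (Ex2 B M N) := ⟨mk (TwoExt.trivial B M N)⟩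

instance : Neg (Ex2 B M N) := ⟨map (-LinearMap.id)⟩

lemma add_def (x y : Ex2 B M N) :
    x + y = map (LinearMap.coprod LinearMap.id LinearMap.id) (prod x y) := rfl

lemma map_zero_left (x : Ex2 B M N) : map (0 : N →ₗ[B] N') x = 0 := by
  induction x using Quot.ind with | mk ξ
  exact map_mk (TwoExt.hasHom_zero ξ)

lemma map_add_left (α β : N →ₗ[B] N') (x : Ex2 B M N) :
    map (α + β) x = map α x + map β x := by
  rw [add_def, ← map_prod, ← map_diag, map_map, map_map]
  congr 1

lemma map_add (α : N →ₗ[B] N') (x y : Ex2 B M N) : map α (x + y) = map α x + map α y := by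
  rw [add_def, add_def, ← map_prod, map_map, map_map]
  congr 1
  ext <;> simp

instance : AddCommGroup (Ex2 B M N) where
  add_assoc x y z := by
    have hz : z = map LinearMap.id z := (map_id z).symm
    have hx : x = map LinearMap.id x := (map_id x).symm
    calc x + y + z = map (LinearMap.coprod LinearMap.id LinearMap.id)
          (prod (map (LinearMap.coprod LinearMap.id LinearMap.id) (prod x y))
            (map LinearMap.id z)) := by rw [← hz]; rfl
      _ = map (LinearMap.coprod LinearMap.id LinearMap.id)
          (prod (map LinearMap.id x)
            (map (LinearMap.coprod LinearMap.id LinearMap.id) (prod y z))) := by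
        rw [← map_prod, ← map_prod, ← map_assoc, map_map, map_map, map_map]
        congr 1
        ext <;> simp
      _ = x + (y + z) := by rw [← hx]; rfl
  zero_add x := by
    calc 0 + x = map (0 : N →ₗ[B] N) x + map LinearMap.id x := by rw [map_zero_left, map_id]
      _ = x := by rw [← map_add_left, zero_add, map_id]
  add_zero x := by
    calc x + 0 = map LinearMap.id x + map (0 : N →ₗ[B] N) x := by rw [map_zero_left, map_id]
      _ = x := by rw [← map_add_left, add_zero, map_id]
  nsmul := nsmulRec
  zsmul := zsmulRec
  neg_add_cancel x := by
    calc -x + x = map (-LinearMap.id) x + map LinearMap.id x := by rw [map_id]; rfl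
      _ = 0 := by rw [← map_add_left, neg_add_cancel, map_zero_left]
  add_comm x y := by
    rw [add_def, add_def, ← map_swap x y, map_map]
    congr 1
    ext <;> simp

variable {C : Type u} [CommRing C] [Algebra B C] [Module C N] [IsScalarTower B C N]

/-- If `N` is a module over the `B`-algebra `C`, then `c ∈ C` acts on `Ex_B²(M,N)` through
pushforward along the multiplication `c : N → N`. -/
instance : Module C (Ex2 B M N) where
  smul c := map (Algebra.lsmul B B N c)
  one_smul x := by
    change map (Algebra.lsmul B B N (1 : C)) x = x
    rw [map_one]; exact map_id x
  mul_smul c c' x := by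
    change map (Algebra.lsmul B B N (c * c')) x =
      map (Algebra.lsmul B B N c) (map (Algebra.lsmul B B N c') x)
    rw [map_map, map_mul]; rfl
  smul_zero c := by
    change map (Algebra.lsmul B B N c) 0 = 0
    rw [← map_zero_left (0 : Ex2 B M N), map_map, LinearMap.comp_zero]
  smul_add c := map_add _
  add_smul c c' x := by
    change map (Algebra.lsmul B B N (c + c')) x = _
    rw [_root_.map_add]; exact map_add_left _ _ _
  zero_smul x := by
    change map (Algebra.lsmul B B N (0 : C)) x = 0
    rw [map_zero, map_zero_left]

end Ex2

/-! ## Infinitesimal extensions of algebras -/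

/-- An infinitesimal extension `0 → M → E → B → 0` of the `A`-algebra `B` by the `B`-module `M`.
(The condition `e * i m = i (p e • m)` makes `i` automatically `A`-linear.) -/
structure InfExt (A : Type v) (B M : Type u) [CommRing A] [CommRing B] [Algebra A B]
    [AddCommGroup M] [Module B M] where
  E : Type u
  [commRing : CommRing E]
  [algebra : Algebra A E]
  i : M →+ E
  p : E →ₐ[A] B
  i_injective : Function.Injective i
  exact_i_p : Function.Exact i p
  p_surjective : Function.Surjective p
  mul_i : ∀ (e : E) (m : M), e * i m = i (p e • m)

/-- The underlying additive group `M ⊕ E` of the ring used to form pushforwards of infinitesimal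
extensions; here `p : E → B` is a ring homomorphism and `M` is a `B`-module. -/
@[ext] structure SqZero {E B : Type u} [CommRing E] [CommRing B] (p : E →+* B) (M : Type u) where
  fst : M
  snd : E

namespace SqZero

variable {E B M : Type u} [CommRing E] [CommRing B] (p : E →+* B) [AddCommGroup M]

instance : Zero (SqZero p M) := ⟨⟨0, 0⟩⟩
instance : One (SqZero p M) := ⟨⟨0, 1⟩⟩
instance : Add (SqZero p M) := ⟨fun x y => ⟨x.1 + y.1, x.2 + y.2⟩⟩
instance : Neg (SqZero p M) := ⟨fun x => ⟨-x.1, -x.2⟩⟩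

variable {p}

@[simp] lemma zero_fst : (0 : SqZero p M).fst = 0 := rfl
@[simp] lemma zero_snd : (0 : SqZero p M).snd = 0 := rfl
@[simp] lemma one_fst : (1 : SqZero p M).fst = 0 := rfl
@[simp] lemma one_snd : (1 : SqZero p M).snd = 1 := rfl
@[simp] lemma add_fst (x y : SqZero p M) : (x + y).fst = x.fst + y.fst := rfl
@[simp] lemma add_snd (x y : SqZero p M) : (x + y).snd = x.snd + y.snd := rfl
@[simp] lemma neg_fst (x : SqZero p M) : (-x).fst = -x.fst := rfl
@[simp] lemma neg_snd (x : SqZero p M) : (-x).snd = -x.snd := rfl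
variable [Module B M]

/-- `(m₁, e₁) (m₂, e₂) = (e₁ m₂ + e₂ m₁, e₁ e₂)`. -/
instance : Mul (SqZero p M) := ⟨fun x y => ⟨p x.2 • y.1 + p y.2 • x.1, x.2 * y.2⟩⟩

@[simp] lemma mul_fst (x y : SqZero p M) :
    (x * y).fst = p x.snd • y.fst + p y.snd • x.fst := rfl
@[simp] lemma mul_snd (x y : SqZero p M) : (x * y).snd = x.snd * y.snd := rfl

instance : CommRing (SqZero p M) where
  add_assoc x y z := by ext <;> simp [add_assoc]
  zero_add x := by ext <;> simp
  add_zero x := by ext <;> simp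
  nsmul := nsmulRec
  zsmul := zsmulRec
  neg_add_cancel x := by ext <;> simp
  add_comm x y := by ext <;> simp [add_comm]
  left_distrib x y z := by
    ext
    · simp only [mul_fst, add_fst, add_snd, map_add]; module
    · simp [mul_add]
  right_distrib x y z := by
    ext
    · simp only [mul_fst, add_fst, add_snd, map_add]; module
    · simp [add_mul]
  zero_mul x := by ext <;> simp
  mul_zero x := by ext <;> simp
  mul_assoc x y z := by
    ext
    · simp only [mul_fst, mul_snd, map_mul]; module
    · simp [mul_assoc]
  one_mul x := by ext <;> simp
  mul_one x := by ext <;> simp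
  mul_comm x y := by
    ext
    · simp [add_comm]
    · simp [mul_comm]

@[simp] lemma sub_fst (x y : SqZero p M) : (x - y).fst = x.fst - y.fst := by
  rw [sub_eq_add_neg, sub_eq_add_neg]; rfl
@[simp] lemma sub_snd (x y : SqZero p M) : (x - y).snd = x.snd - y.snd := by
  rw [sub_eq_add_neg, sub_eq_add_neg]; rfl

variable (p M) in
/-- The ring homomorphism `e ↦ (0, e)`. -/
def inr : E →+* SqZero p M where
  toFun e := ⟨0, e⟩
  map_one' := rfl
  map_zero' := rfl
  map_add' x y := by ext <;> simp
  map_mul' x y := by ext <;> simp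

instance {A : Type v} [CommRing A] [Algebra A E] : Algebra A (SqZero p M) :=
  ((inr M p).comp (algebraMap A E)).toAlgebra

lemma algebraMap_eq {A : Type v} [CommRing A] [Algebra A E] (a : A) :
    algebraMap A (SqZero p M) a = ⟨0, algebraMap A E a⟩ := rfl

end SqZero

namespace InfExt

attribute [instance] commRing algebra

variable {A : Type v} {B M M' M'' : Type u} [CommRing A] [CommRing B] [Algebra A B]
  [AddCommGroup M] [Module B M] [AddCommGroup M'] [Module B M'] [AddCommGroup M''] [Module B M'']

/-- There is a homomorphism of `A`-algebras `ξ.E → ξ'.E` which induces the identity of `B` and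
restricts to `α : M → M'`. -/
def HasHom (α : M →ₗ[B] M') (ξ : InfExt A B M) (ξ' : InfExt A B M') : Prop :=
  ∃ f : ξ.E →ₐ[A] ξ'.E, (∀ m, f (ξ.i m) = ξ'.i (α m)) ∧ ∀ x, ξ'.p (f x) = ξ.p x

/-- Equivalence of infinitesimal extensions (such an `f` is automatically an isomorphism). -/
def Related (ξ ξ' : InfExt A B M) : Prop := HasHom LinearMap.id ξ ξ'

/-- The ideal `{(-α m, i m)}` of `M' ⊕ E`. -/
def pushRel (α : M →ₗ[B] M') (ξ : InfExt A B M) :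
    Ideal (SqZero (ξ.p : ξ.E →+* B) M') where
  carrier := {x | ∃ m, -α m = x.fst ∧ ξ.i m = x.snd}
  zero_mem' := ⟨0, by simp, by simp⟩
  add_mem' := by
    rintro x y ⟨m, h₁, h₂⟩ ⟨m', h₁', h₂'⟩
    refine ⟨m + m', ?_, ?_⟩
    · simp only [map_add, SqZero.add_fst, ← h₁, ← h₁']; abel
    · simp [h₂, h₂']
  smul_mem' := by
    rintro c x ⟨m, h₁, h₂⟩
    refine ⟨ξ.p c.snd • m, ?_, ?_⟩
    · simp [← h₁, ← h₂, ξ.exact_i_p.apply_apply_eq_zero]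
    · simp [← h₂, ξ.mul_i]

lemma mem_pushRel {α : M →ₗ[B] M'} {ξ : InfExt A B M} {x : SqZero (ξ.p : ξ.E →+* B) M'} :
    x ∈ pushRel α ξ ↔ ∃ m, -α m = x.fst ∧ ξ.i m = x.snd := Iff.rfl

/-- The projection `M' ⊕_M E → B`. -/
def pushP (α : M →ₗ[B] M') (ξ : InfExt A B M) :
    (SqZero (ξ.p : ξ.E →+* B) M' ⧸ pushRel α ξ) →ₐ[A] B :=
  Ideal.Quotient.liftₐ (pushRel α ξ)
    { toFun := fun x => ξ.p x.snd
      map_one' := by simp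
      map_zero' := by simp
      map_add' := by simp
      map_mul' := by simp
      commutes' := by simp [SqZero.algebraMap_eq] }
    (by
      rintro x ⟨m, -, h⟩
      change ξ.p x.snd = 0
      rw [← h, ξ.exact_i_p.apply_apply_eq_zero])

lemma pushP_mk (α : M →ₗ[B] M') (ξ : InfExt A B M) (x : SqZero (ξ.p : ξ.E →+* B) M') :
    pushP α ξ (Ideal.Quotient.mk _ x) = ξ.p x.snd := rfl

/-- The pushforward `α_*(ξ)`, that is `0 → M' → M' ⊕_M E → B → 0`. -/
def push (α : M →ₗ[B] M') (ξ : InfExt A B M) : InfExt A B M' where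
  E := SqZero (ξ.p : ξ.E →+* B) M' ⧸ pushRel α ξ
  i :=
    { toFun := fun m => Ideal.Quotient.mk _ ⟨m, 0⟩
      map_zero' := map_zero (Ideal.Quotient.mk (pushRel α ξ))
      map_add' := fun m m' => by
        rw [← map_add]; congr 1; ext <;> simp }
  p := pushP α ξ
  i_injective := by
    rw [injective_iff_map_eq_zero]
    intro m' h
    obtain ⟨m, h₁, h₂⟩ := mem_pushRel.1 (Ideal.Quotient.eq_zero_iff_mem.1 h)
    have : m = 0 := ξ.i_injective (by simpa using h₂)
    subst this
    simpa using h₁.symm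
  exact_i_p := by
    intro x
    obtain ⟨x, rfl⟩ := Ideal.Quotient.mk_surjective x
    rw [pushP_mk]
    constructor
    · intro h
      obtain ⟨m, hm⟩ := (ξ.exact_i_p x.snd).1 h
      exact ⟨x.fst + α m, (Ideal.Quotient.eq).2 (mem_pushRel.2 ⟨-m, by simp, by simp [hm]⟩)⟩
    · rintro ⟨m, h⟩
      rw [← pushP_mk α ξ x, ← h]
      exact map_zero ξ.p
  p_surjective := by
    intro b
    obtain ⟨e, rfl⟩ := ξ.p_surjective b
    exact ⟨Ideal.Quotient.mk _ ⟨0, e⟩, rfl⟩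
  mul_i := by
    intro x m
    obtain ⟨x, rfl⟩ := Ideal.Quotient.mk_surjective x
    rw [pushP_mk]
    change Ideal.Quotient.mk _ x * Ideal.Quotient.mk _ _ = Ideal.Quotient.mk _ _
    rw [← map_mul]
    congr 1
    ext <;> simp

/-- The infinitesimal extension `0 → M ⊕ M' → E ×_B E' → B → 0`, i.e. the pullback of
`0 → M ⊕ M' → E × E' → B × B → 0` along the diagonal `B → B × B`. -/
def prod (ξ : InfExt A B M) (ξ' : InfExt A B M') : InfExt A B (M × M') where
  E := AlgHom.equalizer (ξ.p.comp (AlgHom.fst A ξ.E ξ'.E)) (ξ'.p.comp (AlgHom.snd A ξ.E ξ'.E))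
  i :=
    { toFun := fun m => ⟨(ξ.i m.1, ξ'.i m.2), by
        change ξ.p (ξ.i m.1) = ξ'.p (ξ'.i m.2)
        rw [ξ.exact_i_p.apply_apply_eq_zero, ξ'.exact_i_p.apply_apply_eq_zero]⟩
      map_zero' := by ext <;> simp
      map_add' := fun x y => by ext <;> simp }
  p := (ξ.p.comp (AlgHom.fst A ξ.E ξ'.E)).comp (Subalgebra.val _)
  i_injective := by
    rintro ⟨a, b⟩ ⟨a', b'⟩ h
    have h' : (ξ.i a, ξ'.i b) = (ξ.i a', ξ'.i b') := congrArg Subtype.val h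
    simpa [Prod.ext_iff, ξ.i_injective.eq_iff, ξ'.i_injective.eq_iff] using h'
  exact_i_p := by
    rintro ⟨⟨a, b⟩, hab⟩
    replace hab : ξ.p a = ξ'.p b := hab
    constructor
    · intro h
      replace h : ξ.p a = 0 := h
      obtain ⟨x, rfl⟩ := (ξ.exact_i_p a).1 h
      obtain ⟨y, rfl⟩ := (ξ'.exact_i_p b).1 (hab.symm.trans h)
      exact ⟨(x, y), rfl⟩
    · rintro ⟨⟨x, y⟩, h⟩
      have h' : ξ.i x = a := congrArg (fun z => z.1.1) h
      change ξ.p a = 0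
      rw [← h', ξ.exact_i_p.apply_apply_eq_zero]
  p_surjective := by
    intro b
    obtain ⟨x, hx⟩ := ξ.p_surjective b
    obtain ⟨y, hy⟩ := ξ'.p_surjective b
    exact ⟨⟨(x, y), hx.trans hy.symm⟩, hx⟩
  mul_i := by
    rintro ⟨⟨a, b⟩, hab⟩ ⟨m, m'⟩
    replace hab : ξ.p a = ξ'.p b := hab
    apply Subtype.ext
    refine Prod.ext (ξ.mul_i a m) ((ξ'.mul_i b m').trans ?_)
    rw [← hab]
    rfl

variable (A B M) in
/-- The split infinitesimal extension `0 → M → M ⊕ B → B → 0`. -/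
def trivial : InfExt A B M where
  E := SqZero (RingHom.id B) M
  i :=
    { toFun := fun m => ⟨m, 0⟩
      map_zero' := rfl
      map_add' := fun x y => by ext <;> simp }
  p :=
    { toFun := fun x => x.snd
      map_one' := rfl
      map_zero' := rfl
      map_add' := fun _ _ => rfl
      map_mul' := fun _ _ => rfl
      commutes' := fun _ => rfl }
  i_injective := fun _ _ h => congrArg SqZero.fst h
  exact_i_p := by
    intro x
    constructor
    · intro h
      exact ⟨x.fst, SqZero.ext rfl (Eq.symm h)⟩
    · rintro ⟨m, rfl⟩
      rfl
  p_surjective := fun b => ⟨⟨0, b⟩, rfl⟩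
  mul_i := fun e m => by
    ext
    · change e.snd • m + (0 : B) • e.fst = e.snd • m
      simp
    · change e.snd * 0 = 0
      simp

lemma HasHom.comp {α : M →ₗ[B] M'} {α' : M' →ₗ[B] M''} {ξ : InfExt A B M} {ξ' : InfExt A B M'}
    {ξ'' : InfExt A B M''} (h' : HasHom α' ξ' ξ'') (h : HasHom α ξ ξ') :
    HasHom (α' ∘ₗ α) ξ ξ'' := by
  obtain ⟨f, h₁, h₂⟩ := h
  obtain ⟨f', h₁', h₂'⟩ := h'
  exact ⟨f'.comp f, by simp [h₁, h₁'], by simp [h₂, h₂']⟩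

lemma hasHom_push (α : M →ₗ[B] M') (ξ : InfExt A B M) : HasHom α ξ (push α ξ) := by
  refine ⟨{ (Ideal.Quotient.mk (pushRel α ξ)).comp (SqZero.inr M' (ξ.p : ξ.E →+* B)) with
      commutes' := fun _ => rfl }, fun m => ?_, fun t => rfl⟩
  exact (Ideal.Quotient.eq).2 (mem_pushRel.2 ⟨m, by simp [SqZero.inr], by simp [SqZero.inr]⟩)

/-- The universal property of the pushforward. -/
lemma HasHom.push_related {α : M →ₗ[B] M'} {ξ : InfExt A B M} {ξ' : InfExt A B M'}
    (h : HasHom α ξ ξ') : Related (push α ξ) ξ' := by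
  obtain ⟨f, h₁, h₂⟩ := h
  let g : SqZero (ξ.p : ξ.E →+* B) M' →ₐ[A] ξ'.E :=
    { toFun := fun x => ξ'.i x.fst + f x.snd
      map_one' := by simp
      map_zero' := by simp
      map_add' := fun x y => by
        simp only [SqZero.add_fst, SqZero.add_snd, map_add]; abel
      map_mul' := fun x y => by
        have h0 : ξ'.i x.fst * ξ'.i y.fst = 0 := by
          rw [ξ'.mul_i, ξ'.exact_i_p.apply_apply_eq_zero, zero_smul, map_zero]
        have h3 : f x.snd * ξ'.i y.fst = ξ'.i (ξ.p x.snd • y.fst) := by rw [ξ'.mul_i, h₂]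
        have h4 : ξ'.i x.fst * f y.snd = ξ'.i (ξ.p y.snd • x.fst) := by
          rw [mul_comm, ξ'.mul_i, h₂]
        simp only [SqZero.mul_fst, SqZero.mul_snd, map_add, map_mul, add_mul, mul_add, h0, h3, h4,
          RingHom.coe_coe]
        abel
      commutes' := fun a => by simp [SqZero.algebraMap_eq] }
  refine ⟨Ideal.Quotient.liftₐ (pushRel α ξ) g ?_, fun m => ?_, fun x => ?_⟩
  · rintro x ⟨m, h, h'⟩
    change ξ'.i x.fst + f x.snd = 0
    simp [← h, ← h', h₁]
  · change ξ'.i m + f 0 = ξ'.i m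
    simp
  · obtain ⟨x, rfl⟩ := Ideal.Quotient.mk_surjective x
    change ξ'.p (ξ'.i x.fst + f x.snd) = ξ.p x.snd
    simp [h₂, ξ'.exact_i_p.apply_apply_eq_zero]

lemma HasHom.prod {M₁ M₂ : Type u} [AddCommGroup M₁] [Module B M₁] [AddCommGroup M₂] [Module B M₂]
    {α : M →ₗ[B] M₁} {β : M' →ₗ[B] M₂} {ξ : InfExt A B M} {ξ' : InfExt A B M'}
    {η : InfExt A B M₁} {η' : InfExt A B M₂} (h : HasHom α ξ η) (h' : HasHom β ξ' η') :
    HasHom (LinearMap.prodMap α β) (ξ.prod ξ') (η.prod η') := by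
  obtain ⟨f, h₁, h₂⟩ := h
  obtain ⟨g, k₁, k₂⟩ := h'
  refine ⟨AlgHom.codRestrict ((AlgHom.prodMap f g).comp (Subalgebra.val _)) _ ?_,
    fun m => ?_, fun t => h₂ _⟩
  · rintro ⟨⟨a, b⟩, hab⟩
    replace hab : ξ.p a = ξ'.p b := hab
    change η.p (f a) = η'.p (g b)
    rw [h₂, k₂, hab]
  · exact Subtype.ext (Prod.ext (h₁ _) (k₁ _))

lemma hasHom_id (ξ : InfExt A B M) : HasHom LinearMap.id ξ ξ :=
  ⟨AlgHom.id A _, fun _ => rfl, fun _ => rfl⟩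

lemma hasHom_diag (ξ : InfExt A B M) :
    HasHom (LinearMap.prod LinearMap.id LinearMap.id) ξ (ξ.prod ξ) :=
  ⟨AlgHom.codRestrict (AlgHom.prod (AlgHom.id A _) (AlgHom.id A _)) _ (fun _ => rfl),
    fun _ => rfl, fun _ => rfl⟩

lemma hasHom_swap (ξ : InfExt A B M) (ξ' : InfExt A B M') :
    HasHom (LinearMap.prod (LinearMap.snd B M M') (LinearMap.fst B M M'))
      (ξ.prod ξ') (ξ'.prod ξ) :=
  ⟨AlgHom.codRestrict ((AlgHom.prod (AlgHom.snd A _ _) (AlgHom.fst A _ _)).comp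
      (Subalgebra.val _)) _ (fun t => t.2.symm),
    fun _ => rfl, fun t => t.2.symm⟩

lemma hasHom_assoc (ξ : InfExt A B M) (ξ' : InfExt A B M') (ξ'' : InfExt A B M'') :
    HasHom (LinearEquiv.prodAssoc B M M' M'').toLinearMap
      ((ξ.prod ξ').prod ξ'') (ξ.prod (ξ'.prod ξ'')) := by
  refine ⟨{ toFun := fun t => ⟨(t.1.1.1.1, ⟨(t.1.1.1.2, t.1.2), ?_⟩), ?_⟩
            map_one' := rfl
            map_zero' := rfl
            map_add' := fun _ _ => rfl
            map_mul' := fun _ _ => rfl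
            commutes' := fun _ => rfl }, fun _ => rfl, fun _ => rfl⟩
  · exact Eq.trans (Eq.symm t.1.1.2) t.2
  · exact t.1.1.2

lemma hasHom_zero (ξ : InfExt A B M) : HasHom (0 : M →ₗ[B] M') ξ (trivial A B M') := by
  refine ⟨{ toFun := fun x => (⟨0, ξ.p x⟩ : SqZero (RingHom.id B) M')
            map_one' := ?_
            map_zero' := ?_
            map_add' := fun _ _ => ?_
            map_mul' := fun _ _ => ?_
            commutes' := fun _ => ?_ }, fun m => ?_, fun _ => rfl⟩
  · exact SqZero.ext rfl (map_one ξ.p)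
  · refine SqZero.ext ?_ (map_mul ξ.p _ _)
    change (0 : M') = ξ.p _ • 0 + ξ.p _ • 0
    simp
  · exact SqZero.ext rfl (map_zero ξ.p)
  · exact SqZero.ext (add_zero 0).symm (map_add ξ.p _ _)
  · exact SqZero.ext rfl (ξ.p.commutes _)
  · exact SqZero.ext rfl (ξ.exact_i_p.apply_apply_eq_zero m)

end InfExt

/-- `Exal_A(B,M)`: the equivalence classes of infinitesimal extensions of `B` over `A` by `M`. -/
def Exal (A : Type v) (B M : Type u) [CommRing A] [CommRing B] [Algebra A B]
    [AddCommGroup M] [Module B M] : Type (max v (u + 1)) :=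
  Quot (InfExt.Related (A := A) (B := B) (M := M))

namespace Exal

variable {A : Type v} {B M M' M'' : Type u} [CommRing A] [CommRing B] [Algebra A B]
  [AddCommGroup M] [Module B M] [AddCommGroup M'] [Module B M'] [AddCommGroup M''] [Module B M'']

/-- The class `[ξ]` of an infinitesimal extension. -/
def mk (ξ : InfExt A B M) : Exal A B M := Quot.mk _ ξ

/-- `α_* : Exal_A(B,M) → Exal_A(B,M')`. -/
def map (α : M →ₗ[B] M') : Exal A B M → Exal A B M' :=
  Quot.map (InfExt.push α) fun _ ξ' h =>
    ((InfExt.hasHom_push α ξ').comp h : InfExt.HasHom (α ∘ₗ LinearMap.id) _ _).push_related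

/-- The map `τ : Exal_A(B,M) × Exal_A(B,M') → Exal_A(B,M ⊕ M')`. -/
def prod : Exal A B M → Exal A B M' → Exal A B (M × M') :=
  Quot.map₂ InfExt.prod (fun ξ _ _ h => (InfExt.hasHom_id ξ).prod h)
    (fun _ _ ξ' h => InfExt.HasHom.prod h (InfExt.hasHom_id ξ'))

lemma map_mk {α : M →ₗ[B] M'} {ξ : InfExt A B M} {ξ' : InfExt A B M'}
    (h : InfExt.HasHom α ξ ξ') : map α (mk ξ) = mk ξ' :=
  Quot.sound h.push_related

lemma map_map (α : M →ₗ[B] M') (α' : M' →ₗ[B] M'') (x : Exal A B M) :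
    map α' (map α x) = map (α' ∘ₗ α) x := by
  induction x using Quot.ind with | mk ξ
  exact (map_mk ((InfExt.hasHom_push α' _).comp (InfExt.hasHom_push α ξ))).symm

lemma map_id (x : Exal A B M) : map LinearMap.id x = x := by
  induction x using Quot.ind with | mk ξ
  exact map_mk (InfExt.hasHom_id ξ)

lemma map_prod {M₁ M₂ : Type u} [AddCommGroup M₁] [Module B M₁] [AddCommGroup M₂] [Module B M₂]
    (α : M →ₗ[B] M₁) (β : M' →ₗ[B] M₂) (x : Exal A B M) (y : Exal A B M') :
    map (LinearMap.prodMap α β) (prod x y) = prod (map α x) (map β y) := by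
  induction x using Quot.ind with | mk ξ
  induction y using Quot.ind with | mk ξ'
  exact map_mk ((InfExt.hasHom_push α ξ).prod (InfExt.hasHom_push β ξ'))

lemma map_diag (x : Exal A B M) :
    map (LinearMap.prod LinearMap.id LinearMap.id) x = prod x x := by
  induction x using Quot.ind with | mk ξ
  exact map_mk (InfExt.hasHom_diag ξ)

lemma map_swap (x : Exal A B M) (y : Exal A B M') :
    map (LinearMap.prod (LinearMap.snd B M M') (LinearMap.fst B M M')) (prod x y) = prod y x := by
  induction x using Quot.ind with | mk ξ
  induction y using Quot.ind with | mk ξ'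
  exact map_mk (InfExt.hasHom_swap ξ ξ')

lemma map_assoc (x : Exal A B M) (y : Exal A B M') (z : Exal A B M'') :
    map (LinearEquiv.prodAssoc B M M' M'').toLinearMap (prod (prod x y) z) =
      prod x (prod y z) := by
  induction x using Quot.ind with | mk ξ
  induction y using Quot.ind with | mk ξ'
  induction z using Quot.ind with | mk ξ''
  exact map_mk (InfExt.hasHom_assoc ξ ξ' ξ'')

/-- The sum of classes of infinitesimal extensions: `[ξ] + [ξ'] = (+)_* τ([ξ], [ξ'])`. -/
instance : Add (Exal A B M) :=
  ⟨fun x y => map (LinearMap.coprod LinearMap.id LinearMap.id) (prod x y)⟩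

instance : Zero (Exal A B M) := ⟨mk (InfExt.trivial A B M)⟩

instance : Neg (Exal A B M) := ⟨map (-LinearMap.id)⟩

lemma add_def (x y : Exal A B M) :
    x + y = map (LinearMap.coprod LinearMap.id LinearMap.id) (prod x y) := rfl

lemma map_zero_left (x : Exal A B M) : map (0 : M →ₗ[B] M') x = 0 := by
  induction x using Quot.ind with | mk ξ
  exact map_mk (InfExt.hasHom_zero ξ)

lemma map_add_left (α β : M →ₗ[B] M') (x : Exal A B M) :
    map (α + β) x = map α x + map β x := by
  rw [add_def, ← map_prod, ← map_diag, map_map, map_map]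
  congr 1

lemma map_add (α : M →ₗ[B] M') (x y : Exal A B M) : map α (x + y) = map α x + map α y := by
  rw [add_def, add_def, ← map_prod, map_map, map_map]
  congr 1
  ext <;> simp

instance : AddCommGroup (Exal A B M) where
  add_assoc x y z := by
    have hz : z = map LinearMap.id z := (map_id z).symm
    have hx : x = map LinearMap.id x := (map_id x).symm
    calc x + y + z = map (LinearMap.coprod LinearMap.id LinearMap.id)
          (prod (map (LinearMap.coprod LinearMap.id LinearMap.id) (prod x y))
            (map LinearMap.id z)) := by rw [← hz]; rfl
      _ = map (LinearMap.coprod LinearMap.id LinearMap.id)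
          (prod (map LinearMap.id x)
            (map (LinearMap.coprod LinearMap.id LinearMap.id) (prod y z))) := by
        rw [← map_prod, ← map_prod, ← map_assoc, map_map, map_map, map_map]
        congr 1
        ext <;> simp
      _ = x + (y + z) := by rw [← hx]; rfl
  zero_add x := by
    calc 0 + x = map (0 : M →ₗ[B] M) x + map LinearMap.id x := by rw [map_zero_left, map_id]
      _ = x := by rw [← map_add_left, zero_add, map_id]
  add_zero x := by
    calc x + 0 = map LinearMap.id x + map (0 : M →ₗ[B] M) x := by rw [map_zero_left, map_id]
      _ = x := by rw [← map_add_left, add_zero, map_id]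
  nsmul := nsmulRec
  zsmul := zsmulRec
  neg_add_cancel x := by
    calc -x + x = map (-LinearMap.id) x + map LinearMap.id x := by rw [map_id]; rfl
      _ = 0 := by rw [← map_add_left, neg_add_cancel, map_zero_left]
  add_comm x y := by
    rw [add_def, add_def, ← map_swap x y, map_map]
    congr 1
    ext <;> simp

variable {C : Type u} [CommRing C] [Algebra B C] [Module C M] [IsScalarTower B C M]

/-- If `M` is a module over the `B`-algebra `C`, then `c ∈ C` acts on `Exal_A(B,M)` through
pushforward along the multiplication `c : M → M`. -/
instance : Module C (Exal A B M) where
  smul c := map (Algebra.lsmul B B M c)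
  one_smul x := by
    change map (Algebra.lsmul B B M (1 : C)) x = x
    rw [map_one]; exact map_id x
  mul_smul c c' x := by
    change map (Algebra.lsmul B B M (c * c')) x =
      map (Algebra.lsmul B B M c) (map (Algebra.lsmul B B M c') x)
    rw [map_map, map_mul]; rfl
  smul_zero c := by
    change map (Algebra.lsmul B B M c) 0 = 0
    rw [← map_zero_left (0 : Exal A B M), map_map, LinearMap.comp_zero]
  smul_add c := map_add _
  add_smul c c' x := by
    change map (Algebra.lsmul B B M (c + c')) x = _
    rw [_root_.map_add]; exact map_add_left _ _ _
  zero_smul x := by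
    change map (Algebra.lsmul B B M (0 : C)) x = 0
    rw [map_zero, map_zero_left]

end Exal

/-! ## The map `ψ` -/

namespace InfExt

/-- An exact sequence `0 → K → F → N → 0` of `E`-modules with `F` projective, where the `B`-module
`N` is an `E`-module via `p : E → B`. -/
structure Presentation {A : Type v} {B M : Type u} [CommRing A] [CommRing B] [Algebra A B]
    [AddCommGroup M] [Module B M] (ξ : InfExt A B M) (N : Type u) [AddCommGroup N]
    [Module B N] where
  K : Type u
  F : Type u
  [addCommGroupK : AddCommGroup K]
  [moduleK : Module ξ.E K]
  [addCommGroupF : AddCommGroup F]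
  [moduleF : Module ξ.E F]
  [projective : Module.Projective ξ.E F]
  ι : K →ₗ[ξ.E] F
  π : F →ₛₗ[(ξ.p : ξ.E →+* B)] N
  ι_injective : Function.Injective ι
  exact_ι_π : Function.Exact ι π
  π_surjective : Function.Surjective π

attribute [instance] Presentation.addCommGroupK Presentation.moduleK Presentation.addCommGroupF
  Presentation.moduleF Presentation.projective

end InfExt

namespace Psi

variable {E B C K F N : Type u} [CommRing E] [CommRing B] [CommRing C] [Algebra E B]
  [Algebra E C] [AddCommGroup K] [Module E K] [AddCommGroup F] [Module E F]
  [AddCommGroup N] [Module E N] [Module B N] [Module C N]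
  [IsScalarTower E B N] [IsScalarTower E C N]

variable (B) in
/-- `Tor₁^E(B,N)`, computed from an exact sequence `0 → K → F → N → 0` with `F` projective: the
kernel of `B ⊗_E K → B ⊗_E F`. -/
abbrev tor (ι : K →ₗ[E] F) : Submodule B (B ⊗[E] K) := LinearMap.ker (ι.baseChange B)

lemma tor_exact (ι : K →ₗ[E] F) :
    Function.Exact ((tor B ι).subtype.restrictScalars E) (ι.lTensor B) := by
  intro t
  constructor
  · intro h
    exact ⟨⟨t, h⟩, rfl⟩
  · rintro ⟨y, rfl⟩
    exact y.2

lemma map_comm_map {X Y : Type u} [AddCommGroup X] [Module E X] [AddCommGroup Y] [Module E Y]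
    (g : X →ₗ[E] Y) (ι : K →ₗ[E] F) :
    g.rTensor F ∘ₗ ι.lTensor X = ι.lTensor Y ∘ₗ g.rTensor K := by
  rw [LinearMap.rTensor_comp_lTensor, LinearMap.lTensor_comp_rTensor]

lemma liftBaseChange_exact (h : Function.Surjective (algebraMap E B)) {ι : K →ₗ[E] F}
    {π : F →ₗ[E] N} (hexact : Function.Exact ι π) (hπ : Function.Surjective π) :
    Function.Exact (ι.baseChange B) (π.liftBaseChange B) := by
  have key : ∀ t : B ⊗[E] N, (1 : B) ⊗ₜ[E] (LinearMap.liftBaseChange B (LinearMap.id : N →ₗ[E] N) t)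
      = t := by
    intro t
    induction t with
    | zero => simp
    | add x y hx hy => rw [map_add, TensorProduct.tmul_add, hx, hy]
    | tmul b n =>
      obtain ⟨e, rfl⟩ := h b
      simp [Algebra.algebraMap_eq_smul_one, TensorProduct.smul_tmul]
  have comp : ∀ t : B ⊗[E] F, π.liftBaseChange B t =
      LinearMap.liftBaseChange B (LinearMap.id : N →ₗ[E] N) (π.lTensor B t) := by
    intro t
    induction t with
    | zero => simp
    | add x y hx hy => rw [map_add, map_add, map_add, hx, hy]
    | tmul b n => simp
  intro t
  rw [comp]
  refine Iff.trans ?_ (lTensor_exact B hexact hπ t)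
  constructor
  · intro h0
    rw [← key (π.lTensor B t), h0, TensorProduct.tmul_zero]
  · intro h0
    rw [h0, map_zero]

lemma lTensor_liftBaseChange_exact (h : Function.Surjective (algebraMap E C)) {ι : K →ₗ[E] F}
    {π : F →ₗ[E] N} (hexact : Function.Exact ι π) (hπ : Function.Surjective π) :
    Function.Exact (ι.lTensor C) ((π.liftBaseChange C).restrictScalars E) :=
  liftBaseChange_exact h hexact hπ

/-- The exact sequence `ϑ` of `B`-modules
`0 → Tor₁^E(B,N) → B ⊗_E K → B ⊗_E F → B ⊗_E N = N → 0`. -/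
def theta (h : Function.Surjective (algebraMap E B)) {ι : K →ₗ[E] F} {π : F →ₗ[E] N}
    (hexact : Function.Exact ι π) (hπ : Function.Surjective π) : TwoExt B N (tor B ι) where
  T₁ := B ⊗[E] K
  T₀ := B ⊗[E] F
  i := (tor B ι).subtype
  d := ι.baseChange B
  e := π.liftBaseChange B
  i_injective := Subtype.val_injective
  exact_i_d := by
    intro t
    simp
  exact_d_e := liftBaseChange_exact h hexact hπ
  e_surjective := by
    intro n
    obtain ⟨f, rfl⟩ := hπ n
    exact ⟨1 ⊗ₜ f, by simp⟩

/-- The connecting homomorphism `∂ : Tor₁^E(B,N) → C ⊗_E N ≅ N` of the exact sequence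
`0 → C → E → B → 0`, i.e. the connecting homomorphism of the snake lemma for the diagram with
exact rows
`C ⊗_E K → E ⊗_E K → B ⊗_E K → 0` and `0 → C ⊗_E F → E ⊗_E F → B ⊗_E F`. Here it is regarded as a
homomorphism of `E`-modules. -/
noncomputable def connectingE [Module.Projective E F] (hB : Function.Surjective (algebraMap E B))
    (hC : Function.Surjective (algebraMap E C)) {ι : K →ₗ[E] F} {π : F →ₗ[E] N}
    (hexact : Function.Exact ι π) (hπ : Function.Surjective π)
    {i : C →ₗ[E] E} (hi : Function.Injective i) (hip : Function.Exact i (Algebra.linearMap E B)) :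
    tor B ι →ₗ[E] N :=
  SnakeLemma.δ' (R := E) (K₃ := tor B ι) (C₁ := N)
      (ι.lTensor C) (ι.lTensor E) (ι.lTensor B)
      (i.rTensor K) ((Algebra.linearMap E B).rTensor K) (rTensor_exact K hip hB)
      (i.rTensor F) ((Algebra.linearMap E B).rTensor F) (rTensor_exact F hip hB)
      (map_comm_map i ι) (map_comm_map (Algebra.linearMap E B) ι)
      ((tor B ι).subtype.restrictScalars E) (tor_exact ι)
      ((π.liftBaseChange C).restrictScalars E) (lTensor_liftBaseChange_exact hC hexact hπ)
      (LinearMap.rTensor_surjective K hB)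
      (Module.Flat.rTensor_preserves_injective_linearMap i hi)

/-- The connecting homomorphism `∂ : Tor₁^E(B,N) → C ⊗_E N ≅ N`, as a homomorphism of
`B`-modules. -/
noncomputable def connecting [Module.Projective E F] (hB : Function.Surjective (algebraMap E B))
    (hC : Function.Surjective (algebraMap E C)) {ι : K →ₗ[E] F} {π : F →ₗ[E] N}
    (hexact : Function.Exact ι π) (hπ : Function.Surjective π)
    {i : C →ₗ[E] E} (hi : Function.Injective i) (hip : Function.Exact i (Algebra.linearMap E B)) :
    tor B ι →ₗ[B] N :=
  LinearMap.extendScalarsOfSurjective hB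
    (connectingE hB hC hexact hπ hi hip)

end Psi

namespace InfExt

variable {A : Type v} {B C N : Type u} [CommRing A] [CommRing B] [CommRing C] [Algebra A B]
  [Algebra B C] [AddCommGroup N] [Module B N] [Module C N] [IsScalarTower B C N]

/-- The class `∂_*(ϑ) ∈ Ex_B²(N,N)` attached to the infinitesimal extension
`0 → C → E → B → 0` and to the exact sequence `0 → K → F → N → 0` of `E`-modules. -/
noncomputable def psiClass (hq : Function.Surjective (algebraMap B C)) (ξ : InfExt A B C)
    (P : ξ.Presentation N) : Ex2 B N N :=
  letI : Algebra ξ.E B := (ξ.p : ξ.E →+* B).toAlgebra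
  letI : Algebra ξ.E C := ((algebraMap B C).comp (ξ.p : ξ.E →+* B)).toAlgebra
  letI : Module ξ.E N := Module.compHom N (ξ.p : ξ.E →+* B)
  haveI : IsScalarTower ξ.E B N := ⟨fun e b n => mul_smul (ξ.p e) b n⟩
  haveI : IsScalarTower ξ.E C N := ⟨fun e c n => by
    change (algebraMap B C (ξ.p e) * c) • n = ξ.p e • c • n
    rw [mul_smul, algebraMap_smul]⟩
  let i : C →ₗ[ξ.E] ξ.E :=
    { toFun := ξ.i
      map_add' := map_add ξ.i
      map_smul' := fun e c => by
        change ξ.i (algebraMap B C (ξ.p e) * c) = e * ξ.i c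
        rw [ξ.mul_i, Algebra.smul_def] }
  let π : P.F →ₗ[ξ.E] N :=
    { toFun := P.π
      map_add' := map_add P.π
      map_smul' := fun e f => map_smulₛₗ P.π e f }
  Ex2.mk (TwoExt.push
    (Psi.connecting (B := B) (C := C) (ι := P.ι) (π := π) (i := i) ξ.p_surjective
      (hq.comp ξ.p_surjective) P.exact_ι_π P.π_surjective ξ.i_injective ξ.exact_i_p)
    (Psi.theta (B := B) (ι := P.ι) (π := π) ξ.p_surjective P.exact_ι_π P.π_surjective))

end InfExt

/-! Let `I` be the image of `i` in `E`, so that `B = E/I`. Then `Tor₁^E(B,N)`, the kernel of `K/IK →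
F/IF`, is `(K ∩ IF)/IK`. Since `I` kills `N`, every product `i c • x` lies in `K`; so `Tor₁` is
additively generated by the classes `1 ⊗ y` with `ι y = i c • x`, and `∂` sends such a class to `c •
π x` (`connecting_one_tmul`).

A map from `K → F → N` to a 2-extension `η` of `N` by `N'`, the identity on `N`, induces a morphism
`ϑ → η` with some left-hand component `β`, and then `[η] = β_*[ϑ]`. As `β` is determined by its
values on the generators, so is `[η]`: this is `MapsTo.mk_eq`. In particular `∂_*(ϑ)` is
characterised by the rule `i c • x ↦ c • π x` (`exists_psiClass_eq`).

All the claims about `ψ` now follow by comparing two targets of one presentation. A homomorphism of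
infinitesimal extensions lifts to presentations because the source `F` is projective
(`MapsTo.of_hasHom`). With multiplication by `c` on `C` this gives compatibility with scalars; `c =
1` gives independence of the representative and of the presentation. For sums, a presentation over
`E ×_B E'` maps to the 2-extensions of both summands and of the sum, and the rules agree because `(c
+ c') • n = c • n + c' • n`. -/

namespace Psi

/-! ### Generators of `Tor₁^E(B,N)` and the connecting homomorphism on them -/

variable {E B C K F N : Type u} [CommRing E] [CommRing B] [CommRing C] [Algebra E B]
  [Algebra E C] [AddCommGroup K] [Module E K] [AddCommGroup F] [Module E F]
  [AddCommGroup N] [Module E N] [Module B N] [Module C N]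
  [IsScalarTower E B N] [IsScalarTower E C N]

/-- In `B ⊗ F` the scalar `i m` moves to the left factor, where it becomes `0`. -/
lemma one_tmul_mem_tor {J : Type u} [AddCommGroup J] [Module E J] {i : J →ₗ[E] E}
    (hip : Function.Exact i (Algebra.linearMap E B)) {ι : K →ₗ[E] F} {m : J} {x : F} {y : K}
    (h : ι y = i m • x) : (1 : B) ⊗ₜ[E] y ∈ tor B ι := by
  have h0 : algebraMap E B (i m) = 0 := hip.apply_apply_eq_zero m
  rw [LinearMap.mem_ker, LinearMap.baseChange_tmul, h, ← TensorProduct.smul_tmul,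
    ← Algebra.algebraMap_eq_smul_one, h0, TensorProduct.zero_tmul]

/-- The connecting homomorphism sends the class of `y ∈ K` with `ι y = i c • x` to `c • π x`. -/
lemma connecting_one_tmul [Module.Projective E F] (hB : Function.Surjective (algebraMap E B))
    (hC : Function.Surjective (algebraMap E C)) {ι : K →ₗ[E] F} {π : F →ₗ[E] N}
    (hexact : Function.Exact ι π) (hπ : Function.Surjective π)
    {i : C →ₗ[E] E} (hi : Function.Injective i) (hip : Function.Exact i (Algebra.linearMap E B))
    {c : C} {x : F} {y : K} (h : ι y = i c • x) :
    connecting hB hC hexact hπ hi hip ⟨(1 : B) ⊗ₜ[E] y, one_tmul_mem_tor hip h⟩ = c • π x := by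
  change connectingE hB hC hexact hπ hi hip ⟨(1 : B) ⊗ₜ[E] y, one_tmul_mem_tor hip h⟩ = c • π x
  -- Chase the snake: `1 ⊗ y` in `B ⊗ K` lifts to `1 ⊗ y` in `E ⊗ K`, whose image `1 ⊗ i c • x = i c
  -- ⊗ x` in `E ⊗ F` comes from `c ⊗ x` in `C ⊗ F`, and this maps to `c • π x`.
  refine (SnakeLemma.δ'_eq _ _ _ _ _ _ _ _ _ _ _ _ _ _ _ _ _ _ ((1 : E) ⊗ₜ[E] y) ?_
    (c ⊗ₜ[E] x) ?_).trans ?_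
  · simp
  · simp only [LinearMap.rTensor_tmul, LinearMap.lTensor_tmul, h]
    rw [← TensorProduct.smul_tmul, smul_eq_mul, mul_one]
  · simp

/-- This is the inclusion of `Tor₁` in `(K ∩ IF)/IK`: since `E → B` is surjective, `t` lifts to `E ⊗
K = K`, and right exactness of `- ⊗ F` turns the vanishing of `1 ⊗ ι y` in `B ⊗ F` into a preimage
in `J ⊗ F`. -/
lemma exists_tmul_of_mem_tor {J : Type u} [AddCommGroup J] [Module E J]
    (hB : Function.Surjective (algebraMap E B)) {i : J →ₗ[E] E}
    (hip : Function.Exact i (Algebra.linearMap E B)) {ι : K →ₗ[E] F} {t : B ⊗[E] K}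
    (ht : t ∈ tor B ι) : ∃ (y : K) (z : J ⊗[E] F), t = 1 ⊗ₜ y ∧
      ι y = TensorProduct.lid E F (i.rTensor F z) := by
  obtain ⟨s, rfl⟩ := LinearMap.rTensor_surjective K (g := Algebra.linearMap E B) hB t
  obtain ⟨y, rfl⟩ := (TensorProduct.lid E K).symm.surjective s
  rw [LinearMap.mem_ker] at ht
  have h0 : (Algebra.linearMap E B).rTensor F ((1 : E) ⊗ₜ[E] ι y) = 0 := by simpa using ht
  obtain ⟨z, hz⟩ := (rTensor_exact F hip hB _).1 h0
  exact ⟨y, z, by simp, by simp [hz]⟩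

/-- Two morphisms from `ϑ` to `2`-extensions of `N` by `N'` which agree on the classes of the
elements `y ∈ K` with `ι y = i m • x` have targets in the same class. -/
lemma mk_eq_mk {J N' : Type u} [AddCommGroup J] [Module E J] [AddCommGroup N'] [Module B N']
    (hB : Function.Surjective (algebraMap E B)) {i : J →ₗ[E] E}
    (hip : Function.Exact i (Algebra.linearMap E B)) {ι : K →ₗ[E] F} {π : F →ₗ[E] N}
    (hι : Function.Injective ι) (hexact : Function.Exact ι π) (hπ : Function.Surjective π)
    {η η' : TwoExt B N N'} {β β' : tor B ι →ₗ[B] N'}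
    (h : TwoExt.HasHom β (theta hB hexact hπ) η) (h' : TwoExt.HasHom β' (theta hB hexact hπ) η')
    (hβ : ∀ (m : J) (x : F) (y : K) (hy : ι y = i m • x),
      β ⟨1 ⊗ₜ y, one_tmul_mem_tor hip hy⟩ = β' ⟨1 ⊗ₜ y, one_tmul_mem_tor hip hy⟩) :
    Ex2.mk η = Ex2.mk η' := by
  -- Both classes are pushforwards of `[ϑ]`, so it is enough to show `β = β'`.
  rw [← Ex2.map_mk h, ← Ex2.map_mk h']
  congr 1
  -- Each `z` is given some `y` on which `β` and `β'` agree. Induction on tensors needs no map `J ⊗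
  -- F → Tor₁`; injectivity of `ι` identifies this `y` with any prescribed one at the end.
  have key : ∀ z : J ⊗[E] F, ∃ (y : K) (hy : (1 : B) ⊗ₜ[E] y ∈ tor B ι),
      ι y = TensorProduct.lid E F (i.rTensor F z) ∧ β ⟨1 ⊗ₜ y, hy⟩ = β' ⟨1 ⊗ₜ y, hy⟩ := by
    intro z
    induction z with
    | zero =>
      refine ⟨0, by simp, by simp, ?_⟩
      have : (⟨(1 : B) ⊗ₜ[E] (0 : K), by simp⟩ : tor B ι) = 0 :=
        Subtype.ext (TensorProduct.tmul_zero _ _)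
      rw [this, map_zero, map_zero]
    | add z w hz hw =>
      obtain ⟨y, hy, h₁, h₂⟩ := hz
      obtain ⟨y', hy', h₁', h₂'⟩ := hw
      have hyy : (1 : B) ⊗ₜ[E] (y + y') = 1 ⊗ₜ y + 1 ⊗ₜ y' := TensorProduct.tmul_add _ _ _
      have hmem : (1 : B) ⊗ₜ[E] (y + y') ∈ tor B ι := hyy ▸ add_mem hy hy'
      have : (⟨_, hmem⟩ : tor B ι) = ⟨_, hy⟩ + ⟨_, hy'⟩ := Subtype.ext hyy
      exact ⟨y + y', hmem, by simp [h₁, h₁'], by rw [this, map_add, map_add, h₂, h₂']⟩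
    | tmul m x =>
      have h0 : algebraMap E B (i m) = 0 := hip.apply_apply_eq_zero m
      -- The ideal `I` acts as zero on `N`, so `i m • x` comes from `K`.
      have hx : π (i m • x) = 0 := by
        rw [map_smul, ← algebraMap_smul B, h0, zero_smul]
      obtain ⟨y, hy⟩ := (hexact _).1 hx
      exact ⟨y, one_tmul_mem_tor hip hy, by simp [hy], hβ m x y hy⟩
  ext ⟨t, ht⟩
  obtain ⟨y, z, rfl, hy⟩ := exists_tmul_of_mem_tor hB hip ht
  obtain ⟨y', hmem, h₁, h₂⟩ := key z
  obtain rfl : y' = y := hι (h₁.trans hy.symm)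
  exact h₂

end Psi

/-! ### Induced maps on the left-hand ends of 2-extensions -/

namespace TwoExt

variable {B M N N' : Type u} [CommRing B] [AddCommGroup M] [Module B M]
  [AddCommGroup N] [Module B N] [AddCommGroup N'] [Module B N']

/-- By commutativity `f₁` carries `ker d` into `ker d'`, and both kernels are the left-hand ends.
The formula for `α` is kept beside `HasHom`, whose existential would forget which `f₁` was used. -/
lemma exists_hasHom {ξ : TwoExt B M N} {ξ' : TwoExt B M N'} (f₁ : ξ.T₁ →ₗ[B] ξ'.T₁)
    (f₀ : ξ.T₀ →ₗ[B] ξ'.T₀) (h₁ : ∀ t, f₀ (ξ.d t) = ξ'.d (f₁ t))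
    (h₀ : ∀ t, ξ'.e (f₀ t) = ξ.e t) :
    ∃ α : N →ₗ[B] N', (∀ n, f₁ (ξ.i n) = ξ'.i (α n)) ∧ HasHom α ξ ξ' := by
  have hmem : ∀ n, (f₁ ∘ₗ ξ.i) n ∈ LinearMap.range ξ'.i := fun n => by
    refine (ξ'.exact_i_d _).1 ?_
    rw [LinearMap.comp_apply, ← h₁, ξ.exact_i_d.apply_apply_eq_zero, map_zero]
  have hα : ∀ n, f₁ (ξ.i n) = ξ'.i (((LinearEquiv.ofInjective ξ'.i ξ'.i_injective).symm.toLinearMap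
      ∘ₗ LinearMap.codRestrict _ (f₁ ∘ₗ ξ.i) hmem) n) := fun n =>
    (congrArg Subtype.val ((LinearEquiv.ofInjective ξ'.i ξ'.i_injective).apply_symm_apply
      (LinearMap.codRestrict _ (f₁ ∘ₗ ξ.i) hmem n))).symm
  exact ⟨_, hα, f₁, f₀, hα, h₁, h₀⟩

end TwoExt

/-! ### Maps from presentations to 2-extensions -/

namespace InfExt

variable {A : Type v} {B M M' N N' N'' : Type u} [CommRing A] [CommRing B] [Algebra A B]
  [AddCommGroup M] [Module B M] [AddCommGroup M'] [Module B M'] [AddCommGroup N] [Module B N]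
  [AddCommGroup N'] [Module B N'] [AddCommGroup N''] [Module B N'']

namespace Presentation

variable {ξ : InfExt A B M} {ξ' : InfExt A B M'}

/-- There is a morphism from `0 → K → F → N → 0` to the `2`-extension `η` of `N` by `N'`, the
identity on `N`, which sends the element `i m • x` of `K` to `ρ m (π x)` in `N'`. -/
def MapsTo (P : ξ.Presentation N) (ρ : M → N → N') (η : TwoExt B N N') : Prop :=
  ∃ (k : P.K →ₛₗ[(ξ.p : ξ.E →+* B)] η.T₁) (f : P.F →ₛₗ[(ξ.p : ξ.E →+* B)] η.T₀),
    (∀ y, f (P.ι y) = η.d (k y)) ∧ (∀ x, η.e (f x) = P.π x) ∧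
      ∀ m x y, P.ι y = ξ.i m • x → k y = η.i (ρ m (P.π x))

/-- The class of the target of a morphism is determined by its restriction to `N'`. -/
lemma MapsTo.mk_eq {P : ξ.Presentation N} {ρ : M → N → N'} {η η' : TwoExt B N N'}
    (h : P.MapsTo ρ η) (h' : P.MapsTo ρ η') : Ex2.mk η = Ex2.mk η' := by
  let _ : Algebra ξ.E B := (ξ.p : ξ.E →+* B).toAlgebra
  let _ : Module ξ.E M := Module.compHom M (ξ.p : ξ.E →+* B)
  let _ : Module ξ.E N := Module.compHom N (ξ.p : ξ.E →+* B)
  have _ : IsScalarTower ξ.E B N := ⟨fun e b n => mul_smul (ξ.p e) b n⟩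
  let i : M →ₗ[ξ.E] ξ.E :=
    { toFun := ξ.i
      map_add' := map_add ξ.i
      map_smul' := fun e m => (ξ.mul_i e m).symm }
  let π : P.F →ₗ[ξ.E] N :=
    { toFun := P.π
      map_add' := map_add P.π
      map_smul' := fun e f => map_smulₛₗ P.π e f }
  -- Extension of scalars turns the semilinear pair `(k, f)` into `B`-linear maps from `B ⊗ K` and
  -- `B ⊗ F`, that is, into a morphism from `ϑ`; its left-hand component takes the values of `ρ` on
  -- the generators.
  have key : ∀ ζ : TwoExt B N N', P.MapsTo ρ ζ → ∃ β : Psi.tor B P.ι →ₗ[B] N',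
      TwoExt.HasHom β
        (Psi.theta (B := B) (π := π) ξ.p_surjective P.exact_ι_π P.π_surjective) ζ ∧
      ∀ m x y (hy : P.ι y = i m • x),
        β ⟨1 ⊗ₜ y, Psi.one_tmul_mem_tor ξ.exact_i_p hy⟩ = ρ m (π x) := by
    rintro ζ ⟨k, f, h₁, h₂, h₃⟩
    let _ : Module ξ.E ζ.T₁ := Module.compHom ζ.T₁ (ξ.p : ξ.E →+* B)
    have _ : IsScalarTower ξ.E B ζ.T₁ := ⟨fun e b n => mul_smul (ξ.p e) b n⟩
    let _ : Module ξ.E ζ.T₀ := Module.compHom ζ.T₀ (ξ.p : ξ.E →+* B)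
    have _ : IsScalarTower ξ.E B ζ.T₀ := ⟨fun e b n => mul_smul (ξ.p e) b n⟩
    let k' : P.K →ₗ[ξ.E] ζ.T₁ :=
      { toFun := k
        map_add' := map_add k
        map_smul' := fun e y => map_smulₛₗ k e y }
    let f' : P.F →ₗ[ξ.E] ζ.T₀ :=
      { toFun := f
        map_add' := map_add f
        map_smul' := fun e x => map_smulₛₗ f e x }
    have comm₁ : f'.liftBaseChange B ∘ₗ P.ι.baseChange B = ζ.d ∘ₗ k'.liftBaseChange B := by
      ext y
      simpa [k', f'] using h₁ y
    have comm₀ : ζ.e ∘ₗ f'.liftBaseChange B = π.liftBaseChange B := by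
      ext x
      simpa [f', π] using h₂ x
    obtain ⟨β, hβ, hom⟩ := TwoExt.exists_hasHom
      (ξ := Psi.theta (B := B) (π := π) ξ.p_surjective P.exact_ι_π P.π_surjective) (ξ' := ζ)
      (k'.liftBaseChange B) (f'.liftBaseChange B) (LinearMap.congr_fun comm₁)
      (LinearMap.congr_fun comm₀)
    refine ⟨β, hom, fun m x y hy => ζ.i_injective ?_⟩
    rw [← hβ ⟨1 ⊗ₜ y, Psi.one_tmul_mem_tor ξ.exact_i_p hy⟩]
    change k'.liftBaseChange B (1 ⊗ₜ y) = _
    rw [LinearMap.liftBaseChange_tmul, one_smul]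
    exact h₃ m x y hy
  obtain ⟨β, hom, hβ⟩ := key η h
  obtain ⟨β', hom', hβ'⟩ := key η' h'
  exact Psi.mk_eq_mk (i := i) ξ.p_surjective ξ.exact_i_p P.ι_injective P.exact_ι_π P.π_surjective
    hom hom' fun m x y hy => (hβ m x y hy).trans (hβ' m x y hy).symm

/-- Composition with a morphism of 2-extensions. Only some `t` over each `k y` is asked for, not a
formula in `m` and `π x`, so that it applies directly to `η = ϑ`, where `t` is the class of `1 ⊗ y`.
-/
lemma mapsTo_of_twoExt_hasHom {P : ξ.Presentation N} {ρ : M → N → N''} {β : N' →ₗ[B] N''}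
    {η : TwoExt B N N'} {η' : TwoExt B N N''} (h : TwoExt.HasHom β η η')
    (k : P.K →ₛₗ[(ξ.p : ξ.E →+* B)] η.T₁) (f : P.F →ₛₗ[(ξ.p : ξ.E →+* B)] η.T₀)
    (h₁ : ∀ y, f (P.ι y) = η.d (k y)) (h₂ : ∀ x, η.e (f x) = P.π x)
    (h₃ : ∀ m x y, P.ι y = ξ.i m • x → ∃ t, k y = η.i t ∧ β t = ρ m (P.π x)) :
    P.MapsTo ρ η' := by
  obtain ⟨g₁, g₀, h₁', h₂', h₃'⟩ := h
  refine ⟨g₁.comp k, g₀.comp f, fun y => ?_, fun x => ?_, fun m x y hy => ?_⟩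
  · simp [h₁, h₂']
  · simp [h₂, h₃']
  · obtain ⟨t, ht, ht'⟩ := h₃ m x y hy
    simp [ht, ← ht', h₁']

lemma MapsTo.of_twoExt_hasHom {P : ξ.Presentation N} {ρ : M → N → N'} {ρ' : M → N → N''}
    {β : N' →ₗ[B] N''} {η : TwoExt B N N'} {η' : TwoExt B N N''} (h : P.MapsTo ρ η)
    (h' : TwoExt.HasHom β η η') (hρ : ∀ m n, β (ρ m n) = ρ' m n) : P.MapsTo ρ' η' := by
  obtain ⟨k, f, h₁, h₂, h₃⟩ := h
  exact mapsTo_of_twoExt_hasHom h' k f h₁ h₂ fun m x y hy => ⟨_, h₃ m x y hy, hρ _ _⟩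

/-- The pair `(f, f')` lands in the fibre product over `N` because both components lie over `π`. -/
lemma MapsTo.prod {P : ξ.Presentation N} {ρ : M → N → N'} {ρ' : M → N → N''}
    {η : TwoExt B N N'} {η' : TwoExt B N N''} (h : P.MapsTo ρ η) (h' : P.MapsTo ρ' η') :
    P.MapsTo (fun m n => (ρ m n, ρ' m n)) (η.prod η') := by
  obtain ⟨k, f, h₁, h₂, h₃⟩ := h
  obtain ⟨k', f', h₁', h₂', h₃'⟩ := h'
  let g : P.F →ₛₗ[(ξ.p : ξ.E →+* B)] (η.prod η').T₀ :=
    { toFun := fun x => ⟨(f x, f' x), (h₂ x).trans (h₂' x).symm⟩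
      map_add' := fun x y => Subtype.ext (Prod.ext (map_add f x y) (map_add f' x y))
      map_smul' := fun e x => Subtype.ext (Prod.ext (map_smulₛₗ f e x) (map_smulₛₗ f' e x)) }
  let l : P.K →ₛₗ[(ξ.p : ξ.E →+* B)] (η.prod η').T₁ :=
    { toFun := fun y => (k y, k' y)
      map_add' := fun y z => Prod.ext (map_add k y z) (map_add k' y z)
      map_smul' := fun e y => Prod.ext (map_smulₛₗ k e y) (map_smulₛₗ k' e y) }
  exact ⟨l, g, fun y => Subtype.ext (Prod.ext (h₁ y) (h₁' y)), h₂,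
    fun m x y hy => Prod.ext (h₃ m x y hy) (h₃' m x y hy)⟩

/-- Morphisms out of presentations pull back along homomorphisms of infinitesimal extensions. -/
lemma MapsTo.of_hasHom {α : M →ₗ[B] M'} (h : HasHom α ξ ξ') (P : ξ.Presentation N)
    {P' : ξ'.Presentation N} {ρ : M' → N → N'} {η : TwoExt B N N'} (hη : P'.MapsTo ρ η) :
    P.MapsTo (fun m => ρ (α m)) η := by
  obtain ⟨g, hg₁, hg₂⟩ := h
  obtain ⟨k, f, h₁, h₂, h₃⟩ := hη
  let _ : Module ξ.E N := Module.compHom N (ξ.p : ξ.E →+* B)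
  let _ : Module ξ.E P'.F := Module.compHom P'.F (g : ξ.E →+* ξ'.E)
  let _ : Module ξ.E P'.K := Module.compHom P'.K (g : ξ.E →+* ξ'.E)
  have smulF : ∀ (e : ξ.E) (x : P'.F), e • x = g e • x := fun _ _ => rfl
  have smulK : ∀ (e : ξ.E) (x : P'.K), e • x = g e • x := fun _ _ => rfl
  let π : P.F →ₗ[ξ.E] N :=
    { toFun := P.π
      map_add' := map_add P.π
      map_smul' := fun e f => map_smulₛₗ P.π e f }
  let π' : P'.F →ₗ[ξ.E] N :=
    { toFun := P'.π
      map_add' := map_add P'.π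
      map_smul' := fun e x => by
        rw [smulF, map_smulₛₗ]
        exact congrArg (· • P'.π x) (hg₂ e) }
  -- With `E` acting on `P'.F` through `g`, the map `P.π` lifts along the surjection `P'.π`; only
  -- projectivity of `P.F` is used.
  obtain ⟨φ, hφ⟩ := Module.projective_lifting_property π' π P'.π_surjective
  have hφ' : ∀ x, P'.π (φ x) = P.π x := LinearMap.congr_fun hφ
  have hmem : ∀ y, ∃ z, P'.ι z = φ (P.ι y) := fun y => (P'.exact_ι_π _).1 (by
    rw [hφ', P.exact_ι_π.apply_apply_eq_zero])
  -- `κ` is the restriction of `φ` to `K`. It is chosen as a bare function; its additivity and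
  -- semilinearity are recovered below from injectivity of `P'.ι`.
  choose κ hκ using hmem
  refine ⟨⟨⟨fun y => k (κ y), fun y z => ?_⟩, fun e y => ?_⟩, ⟨⟨fun x => f (φ x), ?_⟩, ?_⟩,
    fun y => ?_, fun x => ?_, fun m x y hy => ?_⟩
  · rw [← map_add]
    congr 1
    exact P'.ι_injective (by simp [hκ])
  · have : κ (e • y) = g e • κ y := P'.ι_injective (by simp [hκ, smulF])
    change k (κ (e • y)) = ξ.p e • k (κ y)
    rw [this, map_smulₛₗ]
    exact congrArg (· • k (κ y)) (hg₂ e)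
  · intro x z
    rw [map_add, map_add]
  · intro e x
    change f (φ (e • x)) = ξ.p e • f (φ x)
    rw [map_smul, smulF, map_smulₛₗ]
    exact congrArg (· • f (φ x)) (hg₂ e)
  · change f (φ (P.ι y)) = η.d (k (κ y))
    rw [← hκ, h₁]
  · exact (h₂ _).trans (hφ' x)
  -- Here `φ (i m • x) = g (i m) • φ x = i' (α m) • φ x`, so the rule for `P'` applies with `α m`.
  · have := h₃ (α m) (φ x) (κ y) (by rw [hκ, hy, map_smul, smulF, hg₁])
    rwa [hφ'] at this

end Presentation

/-! ### Projections of fibre products, and existence of presentations -/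

lemma hasHom_fst (ξ : InfExt A B M) (ξ' : InfExt A B M') :
    HasHom (LinearMap.fst B M M') (ξ.prod ξ') ξ :=
  ⟨(AlgHom.fst A _ _).comp (Subalgebra.val _), fun _ => rfl, fun _ => rfl⟩

lemma hasHom_snd (ξ : InfExt A B M) (ξ' : InfExt A B M') :
    HasHom (LinearMap.snd B M M') (ξ.prod ξ') ξ' :=
  ⟨(AlgHom.snd A _ _).comp (Subalgebra.val _), fun _ => rfl, fun t => t.2.symm⟩

variable (N) in
-- Take the free `E`-module on the underlying set of `N`.
lemma nonempty_presentation (ξ : InfExt A B M) : Nonempty (ξ.Presentation N) := by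
  let _ : Module ξ.E N := Module.compHom N (ξ.p : ξ.E →+* B)
  let g : (N →₀ ξ.E) →ₗ[ξ.E] N := Finsupp.linearCombination ξ.E id
  exact ⟨{
    K := LinearMap.ker g
    F := N →₀ ξ.E
    ι := (LinearMap.ker g).subtype
    π :=
      { toFun := g
        map_add' := map_add g
        map_smul' := fun e x => map_smul g e x }
    ι_injective := Subtype.val_injective
    exact_ι_π := LinearMap.exact_subtype_ker_map g
    π_surjective := Finsupp.linearCombination_id_surjective ξ.E N }⟩

/-! ### Naturality and additivity of the class `∂_*(ϑ)` -/

variable {C : Type u} [CommRing C] [Algebra B C] [Module C N] [IsScalarTower B C N]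

/-- The class `∂_*(ϑ)` is the class of a `2`-extension to which the presentation maps so that
`i c • x` goes to `c • π x`. -/
lemma exists_psiClass_eq (hq : Function.Surjective (algebraMap B C)) (ξ : InfExt A B C)
    (P : ξ.Presentation N) :
    ∃ η : TwoExt B N N, ξ.psiClass hq P = Ex2.mk η ∧ P.MapsTo (fun (c : C) n => c • n) η := by
  let _ : Algebra ξ.E B := (ξ.p : ξ.E →+* B).toAlgebra
  let _ : Algebra ξ.E C := ((algebraMap B C).comp (ξ.p : ξ.E →+* B)).toAlgebra
  let _ : Module ξ.E N := Module.compHom N (ξ.p : ξ.E →+* B)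
  have _ : IsScalarTower ξ.E B N := ⟨fun e b n => mul_smul (ξ.p e) b n⟩
  have _ : IsScalarTower ξ.E C N := ⟨fun e c n => by
    change (algebraMap B C (ξ.p e) * c) • n = ξ.p e • c • n
    rw [mul_smul, algebraMap_smul]⟩
  let i : C →ₗ[ξ.E] ξ.E :=
    { toFun := ξ.i
      map_add' := map_add ξ.i
      map_smul' := fun e c => by
        change ξ.i (algebraMap B C (ξ.p e) * c) = e * ξ.i c
        rw [ξ.mul_i, Algebra.smul_def] }
  let π : P.F →ₗ[ξ.E] N :=
    { toFun := P.π
      map_add' := map_add P.π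
      map_smul' := fun e f => map_smulₛₗ P.π e f }
  let δ := Psi.connecting (B := B) (C := C) (ι := P.ι) (π := π) (i := i) ξ.p_surjective
    (hq.comp ξ.p_surjective) P.exact_ι_π P.π_surjective ξ.i_injective ξ.exact_i_p
  let θ := Psi.theta (B := B) (ι := P.ι) (π := π) ξ.p_surjective P.exact_ι_π P.π_surjective
  have smul_tmul : ∀ {X : Type u} [AddCommGroup X] [Module ξ.E X] (e : ξ.E) (x : X),
      (1 : B) ⊗ₜ[ξ.E] (e • x) = ξ.p e • ((1 : B) ⊗ₜ[ξ.E] x) := fun e x => by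
    rw [← TensorProduct.smul_tmul, ← Algebra.algebraMap_eq_smul_one, TensorProduct.smul_tmul',
      smul_eq_mul, mul_one]
    rfl
  let k : P.K →ₛₗ[(ξ.p : ξ.E →+* B)] B ⊗[ξ.E] P.K :=
    { toFun := fun y => 1 ⊗ₜ y
      map_add' := TensorProduct.tmul_add 1
      map_smul' := smul_tmul }
  let f : P.F →ₛₗ[(ξ.p : ξ.E →+* B)] B ⊗[ξ.E] P.F :=
    { toFun := fun x => 1 ⊗ₜ x
      map_add' := TensorProduct.tmul_add 1
      map_smul' := smul_tmul }
  have hom := TwoExt.hasHom_push δ θ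
  -- The local instances repeat those of `psiClass`, so the class unfolds to that of `push δ θ`. The
  -- map is `y ↦ 1 ⊗ y`, `x ↦ 1 ⊗ x` into `θ`, followed by `θ → push δ θ`.
  refine ⟨_, rfl, Presentation.mapsTo_of_twoExt_hasHom hom k f (fun _ => rfl) (fun x => ?_)
    fun c x y hy => ⟨_, rfl, Psi.connecting_one_tmul ξ.p_surjective (hq.comp ξ.p_surjective)
      P.exact_ι_π P.π_surjective ξ.i_injective ξ.exact_i_p hy⟩⟩
  change π.liftBaseChange B (1 ⊗ₜ x) = P.π x
  rw [LinearMap.liftBaseChange_tmul, one_smul]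
  rfl

/-- The class `∂_*(ϑ)` is natural in the infinitesimal extension, and independent of the
presentation. -/
lemma psiClass_eq_smul_of_hasHom (hq : Function.Surjective (algebraMap B C))
    {ξ ξ' : InfExt A B C} {c : C} (h : HasHom (Algebra.lsmul B B C c) ξ ξ')
    (P : ξ.Presentation N) (P' : ξ'.Presentation N) :
    ξ'.psiClass hq P' = c • ξ.psiClass hq P := by
  obtain ⟨η, hη, hP⟩ := exists_psiClass_eq hq ξ P
  obtain ⟨η', hη', hP'⟩ := exists_psiClass_eq hq ξ' P'
  rw [hη, hη']
  -- `P` maps to `η'` through `P'` and to the pushforward of `η` along `c`, both times by the rule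
  -- `(c', n) ↦ (c * c') • n`.
  exact (Presentation.MapsTo.of_hasHom h P hP').mk_eq
    (hP.of_twoExt_hasHom (TwoExt.hasHom_push (Algebra.lsmul B B N c) η)
      fun c' n => (mul_smul c c' n).symm)

/-- The case `c = 1` of the preceding lemma. For `ξ = ξ'` it gives independence of the presentation.
-/
lemma psiClass_eq_of_related (hq : Function.Surjective (algebraMap B C))
    {ξ ξ' : InfExt A B C} (h : Related ξ ξ') (P : ξ.Presentation N) (P' : ξ'.Presentation N) :
    ξ.psiClass hq P = ξ'.psiClass hq P' := by
  have h' : HasHom (Algebra.lsmul B B C (1 : C)) ξ ξ' := by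
    rw [show Algebra.lsmul B B C (1 : C) = LinearMap.id from map_one _]
    exact h
  rw [psiClass_eq_smul_of_hasHom hq h' P P', one_smul]

/-- A presentation `Q` over `E ×_B E'` maps to `η` and `η'` through the two projections, hence to
their Baer sum by `c.1 • n + c.2 • n`. It also maps to `η''` along `h`, by `(c.1 + c.2) • n`. -/
lemma psiClass_add (hq : Function.Surjective (algebraMap B C)) {ξ ξ' ξ'' : InfExt A B C}
    (h : HasHom (LinearMap.coprod LinearMap.id LinearMap.id) (ξ.prod ξ') ξ'')
    (P : ξ.Presentation N) (P' : ξ'.Presentation N) (P'' : ξ''.Presentation N) :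
    ξ''.psiClass hq P'' = ξ.psiClass hq P + ξ'.psiClass hq P' := by
  obtain ⟨η, hη, hP⟩ := exists_psiClass_eq hq ξ P
  obtain ⟨η', hη', hP'⟩ := exists_psiClass_eq hq ξ' P'
  obtain ⟨η'', hη'', hP''⟩ := exists_psiClass_eq hq ξ'' P''
  obtain ⟨Q⟩ := nonempty_presentation N (ξ.prod ξ')
  rw [hη, hη', hη'']
  have hprod := (Presentation.MapsTo.of_hasHom (hasHom_fst ξ ξ') Q hP).prod
    (Presentation.MapsTo.of_hasHom (hasHom_snd ξ ξ') Q hP')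
  have hom := TwoExt.hasHom_push (LinearMap.coprod LinearMap.id LinearMap.id) (η.prod η')
  have hsum := hprod.of_twoExt_hasHom hom fun c n => (add_smul c.1 c.2 n).symm
  exact (Presentation.MapsTo.of_hasHom h Q hP'').mk_eq hsum

end InfExt

/-! ### The map `ψ` -/

theorem proposition3p6 {A : Type v} {B C N : Type u} [CommRing A] [CommRing B] [CommRing C]
    [Algebra A B] [Algebra B C] (hq : Function.Surjective (algebraMap B C))
    [AddCommGroup N] [Module C N] [Module B N] [IsScalarTower B C N] :
    ∃! ψ : Exal A B C →ₗ[C] Ex2 B N N,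
      ∀ (ξ : InfExt A B C) (P : ξ.Presentation N), ψ (Exal.mk ξ) = ξ.psiClass hq P := by
  have P (ξ : InfExt A B C) : ξ.Presentation N := (InfExt.nonempty_presentation N ξ).some
  let ψ : Exal A B C →ₗ[C] Ex2 B N N :=
    { toFun := Quot.lift (fun ξ => ξ.psiClass hq (P ξ))
        fun ξ ξ' h => InfExt.psiClass_eq_of_related hq h (P ξ) (P ξ')
      map_add' := fun x y => by
        induction x using Quot.ind with | mk ξ
        induction y using Quot.ind with | mk ξ'
        -- The sum of the two classes is by definition represented by the pushforward of `ξ.prod ξ'`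
        -- along addition; `psiClass_add` is stated for any target of such a homomorphism.
        exact InfExt.psiClass_add hq (InfExt.hasHom_push _ _) _ _ _
      map_smul' := fun c x => by
        induction x using Quot.ind with | mk ξ
        exact InfExt.psiClass_eq_smul_of_hasHom hq (InfExt.hasHom_push _ _) _ _ }
  refine ⟨ψ, fun ξ Q => InfExt.psiClass_eq_of_related hq (InfExt.hasHom_id ξ) _ _, fun φ hφ => ?_⟩
  ext x
  induction x using Quot.ind with | mk ξ
  -- Uniqueness: every class has a representative, and every representative has a presentation.
  exact hφ ξ (P ξ)
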